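/- Let $\Gamma_0=\mathbb R\times\mathbb R_*$ (where $\mathbb R_*=\mathbb R\setminus\{0\}$), with points $(b,a)$, be the groupoid over $\mathbb R_*$ whose two projections are $(b,a)\mapsto a$, with inverse $(b,a)\mapsto(-b,a)$ and multiplication $(b,a)(b',a)=(b+b',a)$. For an open set $U\subset\mathbb R^n$ let $\mathcal D(U)$ be the space of smooth complex functions with compact support in $U$, extended by $0$ outside $U$. For $s\in\mathbb R$, $f\in\mathcal D(\Gamma_0)$, $F\in\mathcal D(\Gamma_0\times\Gamma_0)$ and $(b_1,a_1,b_2,a_2)\in\Gamma_0\times\Gamma_0$ put $$(\widehat\delta_s(f)F)(b_1,a_1,b_2,a_2)=\int_{\mathbb R}\frac{db}{|1+sb|}\,f\bigl(b,\,sb+(a_1-sb_1)(a_2-sb_2)\bigr)\,F\Bigl(\tfrac{b_1-b}{1+sb},\,\tfrac{a_1}{1+sb},\,\tfrac{-b+b_2(a_1-sb_1)}{a_1-sb_1+sb},\,\tfrac{a_2(a_1-sb_1)}{a_1-sb_1+sb}\Bigr),$$ the integrand being $0$ where a denominator in the argument of $F$ vanishes. The reduced C*-algebra $C_r^*(\Gamma_0\times\Gamma_0)$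 is the completion of $\mathcal D(\Gamma_0\times\Gamma_0)$ in the norm $\|F\|=\sup\{\|F*G\|_{L^2}: G\in\mathcal D(\Gamma_0\times\Gamma_0),\ \|G\|_{L^2}\le 1\}$, where $$(F*G)(b_1,a_1,b_2,a_2)=\int_{\mathbb R^2}F(c_1,a_1,c_2,a_2)\,G(b_1-c_1,a_1,b_2-c_2,a_2)\,dc_1\,dc_2$$ and $L^2$ refers to the measure $a_1^{-2}a_2^{-2}\,db_1\,da_1\,db_2\,da_2$. **Proposition 6.7.** Let $f\in\mathcal D(\Gamma_0)$ and $F\in\mathcal D(\Gamma_0\times\Gamma_0)$. There exist $\epsilon>0$ and a compact set $K\subset\Gamma_0\times\Gamma_0$ such that for all $s\in\mathbb R$ with $|s|\le\epsilon$ the integral defining $\widehat\delta_s(f)F$ converges absolutely at every point of $\Gamma_0\times\Gamma_0$, $\widehat\delta_s(f)F\in\mathcal D(\Gamma_0\times\Gamma_0)$, and $\widehat\delta_s(f)F$ is supported in $K$. Moreover $$\lim_{s\to0}\bigl(\widehat\delta_s(f)F-\widehat\delta_0(f)F\bigr)=0\quad\text{in } C_r^*(\Gamma_0\times\Gamma_0).$$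 -/

import Mathlib

open Filter MeasureTheory
open scoped ContDiff Topology ENNReal

namespace AxPlusB

/-- The manifold `Γ₀ = ℝ × ℝ_*`, with points `(b, a)`, as an open subset of the plane. As a groupoid
over `A = ℝ_*` it is the bundle of additive groups `ℝ`: both projections are `(b, a) ↦ a`, the
inverse is `(b, a) ↦ (-b, a)` and the product of `(b, a)` and `(b', a)` is `(b + b', a)`. -/
def Gamma0 : Set (ℝ × ℝ) := {p | p.2 ≠ 0}

/-- The manifold `Γ₀ × Γ₀`, with points `((b₁, a₁), (b₂, a₂))`. -/
def Gamma0Sq : Set ((ℝ × ℝ) × (ℝ × ℝ)) := Gamma0 ×ˢ Gamma0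

/-- `φ ∈ 𝒟(U)` for an open set `U`: `φ` is a smooth complex function with compact support
contained in `U` (functions on `U` of compact support are extended by `0`). -/
def IsTestFunction {E : Type*} [NormedAddCommGroup E] [NormedSpace ℝ E]
    (U : Set E) (φ : E → ℂ) : Prop :=
  ContDiff ℝ ∞ φ ∧ HasCompactSupport φ ∧ tsupport φ ⊆ U

/-- The integrand, as a function of `b`, in the definition of `(δ̂_s(f)F)(b₁, a₁, b₂, a₂)`.
Where one of the denominators `1 + s b` and `a₁ - s b₁ + s b` vanishes, one of the `a`-coordinates
at which `F` is evaluated is `0` in Lean, so that the integrand is `0` there, for `F ∈ 𝒟(Γ₀ × Γ₀)`. -/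
noncomputable def deltaHatIntegrand (s : ℝ) (f : ℝ × ℝ → ℂ) (F : (ℝ × ℝ) × (ℝ × ℝ) → ℂ)
    (p : (ℝ × ℝ) × (ℝ × ℝ)) (b : ℝ) : ℂ :=
  let b₁ := p.1.1
  let a₁ := p.1.2
  let b₂ := p.2.1
  let a₂ := p.2.2
  ((1 / |1 + s * b| : ℝ) : ℂ) * f (b, s * b + (a₁ - s * b₁) * (a₂ - s * b₂)) *
    F (((b₁ - b) / (1 + s * b), a₁ / (1 + s * b)),
      ((-b + b₂ * (a₁ - s * b₁)) / (a₁ - s * b₁ + s * b),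
        a₂ * (a₁ - s * b₁) / (a₁ - s * b₁ + s * b)))

/-- The function `δ̂_s(f)F`. -/
noncomputable def deltaHat (s : ℝ) (f : ℝ × ℝ → ℂ) (F : (ℝ × ℝ) × (ℝ × ℝ) → ℂ) :
    (ℝ × ℝ) × (ℝ × ℝ) → ℂ :=
  fun p => ∫ b : ℝ, deltaHatIntegrand s f F p b

/-- The convolution `F * G = π_id(F)G` of the groupoid `Γ₀ × Γ₀`, for the Haar system given by
the Lebesgue measures `db₁ db₂` on the fibres. -/
noncomputable def conv (F G : (ℝ × ℝ) × (ℝ × ℝ) → ℂ) : (ℝ × ℝ) × (ℝ × ℝ) → ℂ :=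
  fun p => ∫ c : ℝ × ℝ, F ((c.1, p.1.2), (c.2, p.2.2)) *
    G ((p.1.1 - c.1, p.1.2), (p.2.1 - c.2, p.2.2))

/-- The measure `a₁⁻² a₂⁻² db₁ da₁ db₂ da₂` on `Γ₀ × Γ₀`, the square of the half density
`Ψ₀ ⊗ Ψ₀`, where `Ψ₀(b, a)(∂_b, ∂_a) = 1 / |a|`. (The complement of `Γ₀ × Γ₀` is a null set.) -/
noncomputable def haarL2Measure : Measure ((ℝ × ℝ) × (ℝ × ℝ)) :=
  volume.withDensity fun p => ENNReal.ofReal (1 / (p.1.2 ^ 2 * p.2.2 ^ 2))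

/-- The norm of `F` in the reduced C*-algebra `C_r*(Γ₀ × Γ₀)`: the operator norm of the
identity representation `π_id(F) : G ↦ F * G` on the dense subspace `𝒟(Γ₀ × Γ₀)` of
`L²(Γ₀ × Γ₀)`. The algebra `C_r*(Γ₀ × Γ₀)` is by definition the completion of `𝒟(Γ₀ × Γ₀)` in this
norm. As the value is taken in `[0, ∞]`, it is `∞` if the operator is not bounded. -/
noncomputable def reducedNorm (F : (ℝ × ℝ) × (ℝ × ℝ) → ℂ) : ℝ≥0∞ :=
  ⨆ (G : (ℝ × ℝ) × (ℝ × ℝ) → ℂ) (_ : IsTestFunction Gamma0Sq G)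
    (_ : eLpNorm G 2 haarL2Measure ≤ 1), eLpNorm (conv F G) 2 haarL2Measure

end AxPlusB

namespace AxPlusB

/-! Where the integrand is nonzero, `f` bounds `b` and `F` confines its four arguments to a box. For
small `s` the factor `1 + s * b` is close to `1`, so the first two arguments bound `b₁` and `a₁`.
Then `a₁ - s * b₁` and `a₁ - s * b₁ + s * b` stay away from `0`, and the last two arguments bound
`b₂` and `a₂`. So one compact set `K` contains all supports, and the integrand vanishes near the
zeros of its denominators, which makes it jointly smooth in `(s, p, b)`. Integrating over a fixed
interval of `b`, `δ̂_s(f)F` is jointly smooth in `(s, p)`, hence converges uniformly on `K` as `s →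
0`. Uniform convergence with common compact support suffices: by `reducedNorm_le` the reduced norm
is at most the sup norm times the area of the fibre support. -/

/-! ### Support bounds uniform in `s` -/

/-- The compact subset `{|b| ≤ M, M⁻¹ ≤ |a| ≤ M}` of `Γ₀`. -/
def box (M : ℝ) : Set (ℝ × ℝ) := Set.Icc (-M) M ×ˢ (Set.Icc (-M) M ∩ {a | M⁻¹ ≤ |a|})

theorem mem_box {M : ℝ} {p : ℝ × ℝ} : p ∈ box M ↔ |p.1| ≤ M ∧ |p.2| ≤ M ∧ M⁻¹ ≤ |p.2| := by
  simp [box, abs_le]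

theorem isCompact_box (M : ℝ) : IsCompact (box M) :=
  isCompact_Icc.prod (isCompact_Icc.inter_right (isClosed_le continuous_const continuous_abs))

theorem box_subset_Gamma0 {M : ℝ} (hM : 0 < M) : box M ⊆ Gamma0 := fun p hp h => by
  have := (mem_box.1 hp).2.2
  rw [h, abs_zero] at this
  exact absurd (inv_pos.2 hM) this.not_gt

/-- Compactness bounds both `p` and `p.2⁻¹`. Allowing every larger `M` lets the supports of `f` and
`F` share one box. -/
theorem exists_subset_box {K : Set (ℝ × ℝ)} (hK : IsCompact K) (h : K ⊆ Gamma0) :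
    ∃ R, ∀ M, R ≤ M → K ⊆ box M := by
  obtain ⟨A, hA⟩ := hK.exists_bound_of_continuousOn (f := fun p : ℝ × ℝ => p)
    continuous_id.continuousOn
  obtain ⟨B, hB⟩ := hK.exists_bound_of_continuousOn (f := fun p : ℝ × ℝ => p.2⁻¹)
    (continuous_snd.continuousOn.inv₀ h)
  refine ⟨max A B, fun M hM p hp => mem_box.2 ?_⟩
  have h1 := norm_prod_le_iff.1 ((hA p hp).trans ((le_max_left _ _).trans hM))
  have h2 := (hB p hp).trans ((le_max_right _ _).trans hM)
  refine ⟨h1.1, h1.2, ?_⟩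
  rw [norm_inv, Real.norm_eq_abs] at h2
  have h3 : 0 < |p.2| := abs_pos.2 (h hp)
  exact inv_le_of_inv_le₀ h3 h2

theorem IsTestFunction.exists_box {f : ℝ × ℝ → ℂ} (hf : IsTestFunction Gamma0 f) :
    ∃ R, ∀ M, R ≤ M → ∀ p, f p ≠ 0 → p ∈ box M := by
  obtain ⟨R, hR⟩ := exists_subset_box hf.2.1 hf.2.2
  exact ⟨R, fun M hM p hp => hR M hM (subset_tsupport f hp)⟩

theorem IsTestFunction.exists_box_prod {F : (ℝ × ℝ) × (ℝ × ℝ) → ℂ}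
    (hF : IsTestFunction Gamma0Sq F) :
    ∃ R, ∀ M, R ≤ M → ∀ p, F p ≠ 0 → p ∈ box M ×ˢ box M := by
  obtain ⟨R₁, h₁⟩ := exists_subset_box (hF.2.1.isCompact.image continuous_fst)
    (Set.image_subset_iff.2 fun p hp => (hF.2.2 hp).1)
  obtain ⟨R₂, h₂⟩ := exists_subset_box (hF.2.1.isCompact.image continuous_snd)
    (Set.image_subset_iff.2 fun p hp => (hF.2.2 hp).2)
  refine ⟨max R₁ R₂, fun M hM p hp => ⟨?_, ?_⟩⟩
  · exact h₁ M ((le_max_left _ _).trans hM) ⟨p, subset_tsupport F hp, rfl⟩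
  · exact h₂ M ((le_max_right _ _).trans hM) ⟨p, subset_tsupport F hp, rfl⟩

/-- Bounds on the coordinates of a point at which the integrand of `δ̂_s(f)F` does not vanish. -/
theorem bounds_of_mem_box {R s b b₁ a₁ b₂ a₂ : ℝ} (hR : 1 ≤ R) (hs : |s| ≤ 1 / (24 * R ^ 2))
    (hb : |b| ≤ R) (h₁ : ((b₁ - b) / (1 + s * b), a₁ / (1 + s * b)) ∈ box R)
    (h₂ : ((-b + b₂ * (a₁ - s * b₁)) / (a₁ - s * b₁ + s * b),
        a₂ * (a₁ - s * b₁) / (a₁ - s * b₁ + s * b)) ∈ box R) :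
    (b₁, a₁) ∈ box (20 * R ^ 3) ∧ (b₂, a₂) ∈ box (20 * R ^ 3) ∧
      1 / 2 ≤ |1 + s * b| ∧ 1 / (4 * R) ≤ |a₁ - s * b₁ + s * b| := by
  have hR0 : 0 < R := by linarith
  obtain ⟨h1, h2, h3⟩ := mem_box.1 h₁
  obtain ⟨h4, h5, h6⟩ := mem_box.1 h₂
  simp only [] at h1 h2 h3 h4 h5 h6
  set r := R⁻¹ with hr
  have hrR : r * R = 1 := inv_mul_cancel₀ hR0.ne'
  have hr0 : 0 < r := inv_pos.2 hR0
  have hr1 : r ≤ 1 := inv_le_one_of_one_le₀ hR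
  have hR2 : 1 ≤ R ^ 2 := one_le_pow₀ hR
  have hR3 : R ≤ R ^ 3 := by nlinarith
  have hR32 : R ^ 2 ≤ R ^ 3 := by nlinarith
  -- The constant 24 gives `|s * b₁| ≤ r / 8` once `|b₁| ≤ 3 * R`, so the second denominator keeps
  -- at least `r / 2 - r / 8 - r / 24 = r / 3`.
  have hs' : |s| * R ≤ r / 24 := by
    calc |s| * R ≤ 1 / (24 * R ^ 2) * R := by gcongr
      _ = r / 24 := by rw [hr]; field_simp
  have hsb : |s * b| ≤ r / 24 := by
    rw [abs_mul]; exact (mul_le_mul_of_nonneg_left hb (abs_nonneg s)).trans hs'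
  have hu1 : 1 / 2 ≤ |1 + s * b| := by
    have := neg_abs_le (s * b); have := le_abs_self (1 + s * b); linarith
  have hu2 : |1 + s * b| ≤ 3 / 2 := by
    have := abs_add_le 1 (s * b); rw [abs_one] at this; linarith
  have hu0 : 0 < |1 + s * b| := by linarith
  rw [abs_div, div_le_iff₀ hu0] at h1 h2
  rw [abs_div, le_div_iff₀ hu0] at h3
  have hb1 : |b₁| ≤ 3 * R := by
    have := abs_sub_abs_le_abs_sub b₁ b; nlinarith
  have ha1 : |a₁| ≤ 2 * R := by nlinarith
  have ha1' : r / 2 ≤ |a₁| := by nlinarith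
  have hsb1 : |s * b₁| ≤ r / 8 := by
    rw [abs_mul]; nlinarith [abs_nonneg s]
  set v := a₁ - s * b₁ with hv
  have hv1 : 3 * r / 8 ≤ |v| := by
    have := abs_sub_abs_le_abs_sub a₁ (s * b₁); linarith
  have hv2 : |v| ≤ 3 * R := by
    have := abs_sub a₁ (s * b₁); linarith
  have hw1 : r / 4 ≤ |v + s * b| := by
    have := abs_sub_abs_le_abs_sub v (-(s * b)); rw [abs_neg, sub_neg_eq_add] at this; linarith
  have hw2 : |v + s * b| ≤ 4 * R := by
    have := abs_add_le v (s * b); linarith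
  have hw0 : 0 < |v + s * b| := by linarith
  rw [abs_div, div_le_iff₀ hw0] at h4 h5
  rw [abs_div, le_div_iff₀ hw0] at h6
  rw [abs_mul] at h5 h6
  have key : ∀ x y : ℝ, 0 ≤ x → x * |v| ≤ y → x ≤ 8 / 3 * R * y := by
    intro x y hx h
    have : x * (3 * r / 8) ≤ y := (mul_le_mul_of_nonneg_left hv1 hx).trans h
    calc x = 8 / 3 * R * (x * (3 * r / 8)) := by linear_combination -x * hrR
      _ ≤ _ := by gcongr
  have hb2 : |b₂| ≤ 8 / 3 * R * (5 * R ^ 2) := by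
    refine key _ _ (abs_nonneg _) ?_
    have := abs_sub_abs_le_abs_sub (b₂ * v) b
    rw [abs_mul, show b₂ * v - b = -b + b₂ * v by ring] at this
    nlinarith [mul_le_mul_of_nonneg_left hw2 hR0.le]
  have ha2 : |a₂| ≤ 8 / 3 * R * (4 * R ^ 2) := by
    refine key _ _ (abs_nonneg _) ?_
    linarith [mul_le_mul_of_nonneg_left hw2 hR0.le]
  have ha2' : r * (r / 4) ≤ |a₂| * (3 * R) := by
    calc r * (r / 4) ≤ r * |v + s * b| := by gcongr
      _ ≤ |a₂| * |v| := h6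
      _ ≤ _ := by gcongr
  -- `20 * R ^ 3` exceeds the largest upper bound, `40 / 3 * R ^ 3`, and its inverse lies below the
  -- smallest lower bound, `r ^ 3 / 12` for `|a₂|`.
  have hinv : (20 * R ^ 3)⁻¹ = r ^ 3 / 20 := by rw [hr]; field_simp
  have hr2 : r ^ 3 ≤ r := by nlinarith [pow_le_one₀ hr0.le hr1 (n := 2)]
  refine ⟨mem_box.2 ⟨?_, ?_, ?_⟩, mem_box.2 ⟨?_, ?_, ?_⟩, hu1, ?_⟩
  · simp only []; linarith
  · simp only []; linarith
  · simp only [hinv]; linarith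
  · simp only []; linarith
  · simp only []; linarith [pow_pos hR0 3]
  · simp only [hinv]
    have h : r * (r * (r / 4)) ≤ r * (|a₂| * (3 * R)) := by gcongr
    have h' : r * (|a₂| * (3 * R)) = 3 * |a₂| := by linear_combination 3 * |a₂| * hrR
    linarith [pow_pos hr0 3]
  · rw [show 1 / (4 * R) = r / 4 by rw [hr]; field_simp]; exact hw1

/-! ### Reduced norm against sup norm -/

/-- Cauchy–Schwarz against the constant `1` on `B`. -/
theorem sq_setLIntegral_le {α : Type*} [MeasurableSpace α] (μ : Measure α) (B : Set α)
    {g : α → ℝ≥0∞} (hg : Measurable g) :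
    (∫⁻ x in B, g x ∂μ) ^ 2 ≤ μ B * ∫⁻ x in B, g x ^ 2 ∂μ := by
  have h := ENNReal.lintegral_mul_le_Lp_mul_Lq (μ.restrict B) Real.HolderConjugate.two_two
    (f := fun _ => 1) (g := g) aemeasurable_const hg.aemeasurable
  have h2 : ∀ x : ℝ≥0∞, (x ^ (1 / 2 : ℝ)) ^ 2 = x := fun x => by
    rw [← ENNReal.rpow_natCast, ← ENNReal.rpow_mul]; norm_num
  calc (∫⁻ x in B, g x ∂μ) ^ 2
      ≤ (μ B ^ (1 / 2 : ℝ) * (∫⁻ x in B, g x ^ 2 ∂μ) ^ (1 / 2 : ℝ)) ^ 2 := by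
        gcongr
        simpa using h
    _ = μ B * ∫⁻ x in B, g x ^ 2 ∂μ := by
        rw [mul_pow, h2, h2]

theorem eLpNorm_two_sq {α : Type*} [MeasurableSpace α] (μ : Measure α) (g : α → ℂ) :
    eLpNorm g 2 μ ^ 2 = ∫⁻ x, ‖g x‖ₑ ^ 2 ∂μ := by
  rw [eLpNorm_eq_lintegral_rpow_enorm_toReal two_ne_zero ENNReal.ofNat_ne_top,
    ← ENNReal.rpow_natCast, ← ENNReal.rpow_mul]
  norm_num

theorem measurable_weight :
    Measurable fun p : (ℝ × ℝ) × (ℝ × ℝ) => ENNReal.ofReal (1 / (p.1.2 ^ 2 * p.2.2 ^ 2)) := by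
  fun_prop

/-- Translations along the fibres of `Γ₀ × Γ₀` preserve the measure. -/
theorem lintegral_haarL2Measure_translate {h : (ℝ × ℝ) × (ℝ × ℝ) → ℝ≥0∞} (hh : Measurable h)
    (c : ℝ × ℝ) :
    ∫⁻ p, h ((p.1.1 - c.1, p.1.2), (p.2.1 - c.2, p.2.2)) ∂haarL2Measure
      = ∫⁻ p, h p ∂haarL2Measure := by
  have h₂ : (volume : Measure (ℝ × ℝ)).IsAddRightInvariant :=
    inferInstanceAs ((volume : Measure ℝ).prod volume).IsAddRightInvariant
  have h₄ : (volume : Measure ((ℝ × ℝ) × (ℝ × ℝ))).IsAddRightInvariant :=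
    inferInstanceAs ((volume : Measure (ℝ × ℝ)).prod volume).IsAddRightInvariant
  rw [haarL2Measure, lintegral_withDensity_eq_lintegral_mul _ measurable_weight hh,
    lintegral_withDensity_eq_lintegral_mul _ measurable_weight (by fun_prop),
    ← lintegral_sub_right_eq_self (μ := volume)
      ((fun p : (ℝ × ℝ) × (ℝ × ℝ) => ENNReal.ofReal (1 / (p.1.2 ^ 2 * p.2.2 ^ 2))) * h)
      (((c.1, 0), (c.2, 0)) : (ℝ × ℝ) × (ℝ × ℝ))]
  refine lintegral_congr fun p => ?_
  have hp : p - ((c.1, 0), (c.2, 0)) = ((p.1.1 - c.1, p.1.2), (p.2.1 - c.2, p.2.2)) := by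
    ext <;> simp
  simp [hp]

instance : SFinite haarL2Measure := by unfold haarL2Measure; infer_instance

/-- The `L²` norm of `D * G`, for `D` bounded by `m` and supported over a bounded part `B` of the
fibres. -/
theorem lintegral_conv_sq_le {D G : (ℝ × ℝ) × (ℝ × ℝ) → ℂ} {B : Set (ℝ × ℝ)}
    (hB : MeasurableSet B) {m : ℝ≥0∞} (hD : ∀ p, ‖D p‖ₑ ≤ m)
    (hDB : ∀ p, D p ≠ 0 → (p.1.1, p.2.1) ∈ B) (hG : Measurable G) :
    ∫⁻ p, ‖conv D G p‖ₑ ^ 2 ∂haarL2Measure ≤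
      (m * volume B) ^ 2 * ∫⁻ p, ‖G p‖ₑ ^ 2 ∂haarL2Measure := by
  have hpt : ∀ p, ‖conv D G p‖ₑ ^ 2 ≤ m ^ 2 * (volume B *
      ∫⁻ c in B, ‖G ((p.1.1 - c.1, p.1.2), (p.2.1 - c.2, p.2.2))‖ₑ ^ 2) := fun p => by
    calc ‖conv D G p‖ₑ ^ 2
        ≤ (∫⁻ c in B, m * ‖G ((p.1.1 - c.1, p.1.2), (p.2.1 - c.2, p.2.2))‖ₑ) ^ 2 := by
          gcongr
          rw [← lintegral_indicator hB]
          refine (enorm_integral_le_lintegral_enorm _).trans (lintegral_mono fun c => ?_)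
          by_cases hc : c ∈ B
          · rw [Set.indicator_of_mem hc, enorm_mul]
            gcongr
            exact hD _
          · have : D ((c.1, p.1.2), (c.2, p.2.2)) = 0 := by
              by_contra h
              exact hc (hDB _ h)
            simp [this]
      _ = m ^ 2 * (∫⁻ c in B, ‖G ((p.1.1 - c.1, p.1.2), (p.2.1 - c.2, p.2.2))‖ₑ) ^ 2 := by
          rw [lintegral_const_mul _ (by fun_prop), mul_pow]
      _ ≤ _ := by
          gcongr
          exact sq_setLIntegral_le _ _ (by fun_prop)
  have hmeas : Measurable fun q : ((ℝ × ℝ) × (ℝ × ℝ)) × (ℝ × ℝ) =>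
      ‖G ((q.1.1.1 - q.2.1, q.1.1.2), (q.1.2.1 - q.2.2, q.1.2.2))‖ₑ ^ 2 := by fun_prop
  calc ∫⁻ p, ‖conv D G p‖ₑ ^ 2 ∂haarL2Measure
      ≤ ∫⁻ p, m ^ 2 * (volume B * ∫⁻ c in B,
          ‖G ((p.1.1 - c.1, p.1.2), (p.2.1 - c.2, p.2.2))‖ₑ ^ 2) ∂haarL2Measure :=
        lintegral_mono hpt
    _ = m ^ 2 * (volume B * ∫⁻ c in B, ∫⁻ p,
          ‖G ((p.1.1 - c.1, p.1.2), (p.2.1 - c.2, p.2.2))‖ₑ ^ 2 ∂haarL2Measure) := by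
        -- Tonelli: with `p` innermost, translation invariance removes the dependence on `c`.
        rw [lintegral_const_mul, lintegral_const_mul, lintegral_lintegral_swap hmeas.aemeasurable]
        · exact hmeas.lintegral_prod_right'
        · exact hmeas.lintegral_prod_right'.const_mul _
    _ = m ^ 2 * (volume B * ((∫⁻ p, ‖G p‖ₑ ^ 2 ∂haarL2Measure) * volume B)) := by
        congr 2
        rw [← setLIntegral_const]
        refine lintegral_congr fun c => ?_
        exact lintegral_haarL2Measure_translate (h := fun p => ‖G p‖ₑ ^ 2) (by fun_prop) c
    _ = _ := by ring

/-- Young's inequality `L¹ * L² ⊆ L²` along the fibres, where `D` has `L¹` norm at most `m * volume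
B`. -/
theorem reducedNorm_le {D : (ℝ × ℝ) × (ℝ × ℝ) → ℂ} {B : Set (ℝ × ℝ)}
    (hB : MeasurableSet B) {m : ℝ≥0∞} (hD : ∀ p, ‖D p‖ₑ ≤ m)
    (hDB : ∀ p, D p ≠ 0 → (p.1.1, p.2.1) ∈ B) : reducedNorm D ≤ m * volume B := by
  refine iSup_le fun G => iSup_le fun hG => iSup_le fun hG1 => ?_
  rw [← ENNReal.pow_le_pow_left_iff two_ne_zero, eLpNorm_two_sq]
  refine (lintegral_conv_sq_le hB hD hDB hG.1.continuous.measurable).trans ?_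
  rw [← eLpNorm_two_sq]
  exact mul_le_of_le_one_right' (pow_le_one₀ zero_le hG1)

/-! ### Joint smoothness in `s` and the point -/

/-- Integration over `ℝ` preserves smoothness in parameters, for integrands that vanish outside
a fixed compact set. -/
theorem contDiffOn_integral_of_compact_support {P : Type*} [NormedAddCommGroup P]
    [NormedSpace ℝ P] {H : P → ℝ → ℂ} {S : Set P} {k : Set ℝ} (hS : IsOpen S) (hk : IsCompact k)
    (h0 : ∀ p x, p ∈ S → x ∉ k → H p x = 0)
    (hH : ContDiffOn ℝ ∞ (fun q : P × ℝ => H q.1 q.2) (S ×ˢ Set.univ)) :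
    ContDiffOn ℝ ∞ (fun p => ∫ x, H p x) S := by
  -- The integral is the convolution of the constant `1` with the reflected integrand, evaluated at
  -- `0`.
  have h := contDiffOn_convolution_right_with_param (𝕜 := ℝ) (μ := (volume : Measure ℝ))
    (n := ⊤) (f := fun _ : ℝ => (1 : ℝ)) (ContinuousLinearMap.lsmul ℝ ℝ)
    (g := fun p x => H p (-x)) (k := -k) hS hk.neg
    (fun p x hp hx => h0 p (-x) hp (by simpa using hx)) (locallyIntegrable_const _)
    (hH.comp (g := fun q : P × ℝ => H q.1 q.2) (f := fun q : P × ℝ => (q.1, -q.2))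
      (by fun_prop) (fun q hq => ⟨hq.1, trivial⟩))
  refine ((h.comp (f := fun p : P => (p, (0 : ℝ))) (by fun_prop)
    (fun p hp => ⟨hp, trivial⟩))).congr fun p hp => ?_
  simp [convolution]

/-- The integrand of `δ̂_s(f)F` vanishes outside a compact set independent of `s`, and outside a
neighbourhood of the zeros of its denominators. -/
theorem exists_bounds_deltaHatIntegrand {f : ℝ × ℝ → ℂ} {F : (ℝ × ℝ) × (ℝ × ℝ) → ℂ}
    (hf : IsTestFunction Gamma0 f) (hF : IsTestFunction Gamma0Sq F) :
    ∃ ε > 0, ∃ M > 0, ∃ c > 0, ∀ s : ℝ, |s| < ε → ∀ p b, deltaHatIntegrand s f F p b ≠ 0 →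
      p ∈ box M ×ˢ box M ∧ |b| ≤ M ∧ c ≤ |1 + s * b| ∧ c ≤ |p.1.2 - s * p.1.1 + s * b| := by
  obtain ⟨R₁, h₁⟩ := hf.exists_box
  obtain ⟨R₂, h₂⟩ := hF.exists_box_prod
  obtain ⟨R, hR, hR₁, hR₂⟩ : ∃ R, 1 ≤ R ∧ R₁ ≤ R ∧ R₂ ≤ R :=
    ⟨max 1 (max R₁ R₂), le_max_left _ _, (le_max_left _ _).trans (le_max_right _ _),
      (le_max_right _ _).trans (le_max_right _ _)⟩
  have hR0 : 0 < R := by linarith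
  refine ⟨1 / (24 * R ^ 2), by positivity, 20 * R ^ 3, by positivity, min (1 / 2) (1 / (4 * R)),
    by positivity, fun s hs p b hne => ?_⟩
  have hf0 := right_ne_zero_of_mul (left_ne_zero_of_mul hne)
  have hF0 := right_ne_zero_of_mul hne
  have hb := (mem_box.1 (h₁ R hR₁ _ hf0)).1
  have hFm := h₂ R hR₂ _ hF0
  obtain ⟨k₁, k₂, k₃, k₄⟩ := bounds_of_mem_box hR hs.le hb hFm.1 hFm.2
  exact ⟨⟨k₁, k₂⟩, hb.trans (by nlinarith [one_le_pow₀ hR (n := 2)]),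
    (min_le_left _ _).trans k₃, (min_le_right _ _).trans k₄⟩

theorem contDiffOn_deltaHatIntegrand {f : ℝ × ℝ → ℂ} {F : (ℝ × ℝ) × (ℝ × ℝ) → ℂ}
    (hf : ContDiff ℝ ∞ f) (hF : ContDiff ℝ ∞ F) {ε c : ℝ} (hc : 0 < c)
    (h : ∀ s : ℝ, |s| < ε → ∀ p b, deltaHatIntegrand s f F p b ≠ 0 →
      c ≤ |1 + s * b| ∧ c ≤ |p.1.2 - s * p.1.1 + s * b|) :
    ContDiffOn ℝ ∞ (fun q : (ℝ × ((ℝ × ℝ) × (ℝ × ℝ))) × ℝ => deltaHatIntegrand q.1.1 f F q.1.2 q.2)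
      ({q : ℝ × ((ℝ × ℝ) × (ℝ × ℝ)) | |q.1| < ε} ×ˢ Set.univ) := by
  intro q hq
  refine ContDiffAt.contDiffWithinAt ?_
  by_cases hd : 1 + q.1.1 * q.2 ≠ 0 ∧ q.1.2.1.2 - q.1.1 * q.1.2.1.1 + q.1.1 * q.2 ≠ 0
  · obtain ⟨hu, hw⟩ := hd
    have hu' : |1 + q.1.1 * q.2| ≠ 0 := abs_ne_zero.2 hu
    have habs : ContDiffAt ℝ ∞
        (fun q : (ℝ × ((ℝ × ℝ) × (ℝ × ℝ))) × ℝ => |1 + q.1.1 * q.2|) q :=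
      ContDiffAt.abs (by fun_prop) hu
    have h1 : ContDiffAt ℝ ∞ (fun q : (ℝ × ((ℝ × ℝ) × (ℝ × ℝ))) × ℝ =>
        ((1 / |1 + q.1.1 * q.2| : ℝ) : ℂ)) q :=
      Complex.ofRealCLM.contDiff.contDiffAt.comp q (contDiffAt_const.div habs hu')
    have h2 : ContDiffAt ℝ ∞ (fun q : (ℝ × ((ℝ × ℝ) × (ℝ × ℝ))) × ℝ =>
        f (q.2, q.1.1 * q.2 + (q.1.2.1.2 - q.1.1 * q.1.2.1.1) *
          (q.1.2.2.2 - q.1.1 * q.1.2.2.1))) q :=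
      (hf.comp (by fun_prop)).contDiffAt
    have h3 : ContDiffAt ℝ ∞ (fun q : (ℝ × ((ℝ × ℝ) × (ℝ × ℝ))) × ℝ =>
        F (((q.1.2.1.1 - q.2) / (1 + q.1.1 * q.2), q.1.2.1.2 / (1 + q.1.1 * q.2)),
          ((-q.2 + q.1.2.2.1 * (q.1.2.1.2 - q.1.1 * q.1.2.1.1)) /
            (q.1.2.1.2 - q.1.1 * q.1.2.1.1 + q.1.1 * q.2),
          q.1.2.2.2 * (q.1.2.1.2 - q.1.1 * q.1.2.1.1) /
            (q.1.2.1.2 - q.1.1 * q.1.2.1.1 + q.1.1 * q.2)))) q := by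
      refine hF.contDiffAt.comp q ?_
      refine ContDiffAt.prodMk (ContDiffAt.prodMk ?_ ?_) (ContDiffAt.prodMk ?_ ?_)
      · exact ContDiffAt.div (by fun_prop) (by fun_prop) hu
      · exact ContDiffAt.div (by fun_prop) (by fun_prop) hu
      · exact ContDiffAt.div (by fun_prop) (by fun_prop) hw
      · exact ContDiffAt.div (by fun_prop) (by fun_prop) hw
    exact (h1.mul h2).mul h3
  -- At a zero of a denominator, that denominator is below `c` nearby, so the integrand is locally
  -- zero.
  · refine (contDiffAt_const (c := (0 : ℂ))).congr_of_eventuallyEq ?_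
    have hev : ∀ᶠ r : (ℝ × ((ℝ × ℝ) × (ℝ × ℝ))) × ℝ in 𝓝 q, |r.1.1| < ε :=
      (by fun_prop : Continuous fun r : (ℝ × ((ℝ × ℝ) × (ℝ × ℝ))) × ℝ => |r.1.1|).continuousAt
        |>.eventually_lt_const hq.1
    rw [not_and_or, not_not, not_not] at hd
    rcases hd with hd | hd
    · have hev2 : ∀ᶠ r : (ℝ × ((ℝ × ℝ) × (ℝ × ℝ))) × ℝ in 𝓝 q, |1 + r.1.1 * r.2| < c :=
        (by fun_prop : Continuous fun r : (ℝ × ((ℝ × ℝ) × (ℝ × ℝ))) × ℝ =>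
          |1 + r.1.1 * r.2|).continuousAt.eventually_lt_const (by simpa only [hd, abs_zero] using hc)
      filter_upwards [hev, hev2] with r hr hr2
      by_contra hne
      exact absurd (h _ hr _ _ hne).1 hr2.not_ge
    · have hev2 : ∀ᶠ r : (ℝ × ((ℝ × ℝ) × (ℝ × ℝ))) × ℝ in 𝓝 q,
          |r.1.2.1.2 - r.1.1 * r.1.2.1.1 + r.1.1 * r.2| < c :=
        (by fun_prop : Continuous fun r : (ℝ × ((ℝ × ℝ) × (ℝ × ℝ))) × ℝ =>
          |r.1.2.1.2 - r.1.1 * r.1.2.1.1 + r.1.1 * r.2|).continuousAt.eventually_lt_const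
            (by simpa only [hd, abs_zero] using hc)
      filter_upwards [hev, hev2] with r hr hr2
      by_contra hne
      exact absurd (h _ hr _ _ hne).2 hr2.not_ge

end AxPlusB

/-! ### The main theorem -/

theorem proposition6p7 (f : ℝ × ℝ → ℂ) (F : (ℝ × ℝ) × (ℝ × ℝ) → ℂ)
    (hf : AxPlusB.IsTestFunction AxPlusB.Gamma0 f)
    (hF : AxPlusB.IsTestFunction AxPlusB.Gamma0Sq F) :
    (∃ ε : ℝ, 0 < ε ∧ ∃ K : Set ((ℝ × ℝ) × (ℝ × ℝ)),
      IsCompact K ∧ K ⊆ AxPlusB.Gamma0Sq ∧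
      ∀ s : ℝ, |s| ≤ ε →
        (∀ p ∈ AxPlusB.Gamma0Sq, Integrable (AxPlusB.deltaHatIntegrand s f F p)) ∧
        AxPlusB.IsTestFunction AxPlusB.Gamma0Sq (AxPlusB.deltaHat s f F) ∧
        tsupport (AxPlusB.deltaHat s f F) ⊆ K) ∧
    Tendsto (fun s : ℝ => AxPlusB.reducedNorm
      (AxPlusB.deltaHat s f F - AxPlusB.deltaHat 0 f F)) (𝓝 0) (𝓝 0) := by
  obtain ⟨ε, hε, M, hM, c, hc, h⟩ := AxPlusB.exists_bounds_deltaHatIntegrand hf hF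
  set K := AxPlusB.box M ×ˢ AxPlusB.box M with hKdef
  have hK : IsCompact K := (AxPlusB.isCompact_box M).prod (AxPlusB.isCompact_box M)
  have hKΓ : K ⊆ AxPlusB.Gamma0Sq :=
    Set.prod_mono (AxPlusB.box_subset_Gamma0 hM) (AxPlusB.box_subset_Gamma0 hM)
  set S : Set (ℝ × ((ℝ × ℝ) × (ℝ × ℝ))) := {q | |q.1| < ε} with hS
  have hSo : IsOpen S := isOpen_lt (by fun_prop) continuous_const
  have hI := AxPlusB.contDiffOn_deltaHatIntegrand hf.1 hF.1 hc
    fun s hs p b hne => (h s hs p b hne).2.2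
  have hb0 : ∀ s : ℝ, |s| < ε → ∀ p, ∀ b ∉ Set.Icc (-M) M,
      AxPlusB.deltaHatIntegrand s f F p b = 0 := fun s hs p b hb => by
    by_contra hne
    exact hb (abs_le.1 (h s hs p b hne).2.1)
  have hδ : ContDiffOn ℝ ∞
      (fun q : ℝ × ((ℝ × ℝ) × (ℝ × ℝ)) => AxPlusB.deltaHat q.1 f F q.2) S :=
    AxPlusB.contDiffOn_integral_of_compact_support
      (H := fun q : ℝ × ((ℝ × ℝ) × (ℝ × ℝ)) => AxPlusB.deltaHatIntegrand q.1 f F q.2)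
      hSo isCompact_Icc (fun q b hq hb => hb0 _ hq _ _ hb) hI
  have hsupp : ∀ s : ℝ, |s| < ε → ∀ p, AxPlusB.deltaHat s f F p ≠ 0 → p ∈ K := by
    intro s hs p hne
    by_contra hp
    refine hne (integral_eq_zero_of_ae (Eventually.of_forall fun b => ?_))
    by_contra hb
    exact hp (h s hs p b hb).1
  -- Halving turns the strict bound `|s| < ε` into a non-strict one.
  refine ⟨⟨ε / 2, half_pos hε, K, hK, hKΓ, fun s hs => ?_⟩, ?_⟩
  · have hs' : |s| < ε := hs.trans_lt (half_lt_self hε)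
    have htK : tsupport (AxPlusB.deltaHat s f F) ⊆ K :=
      closure_minimal (hsupp s hs') hK.isClosed
    refine ⟨fun p _ => ?_, ⟨?_, ?_, htK.trans hKΓ⟩, htK⟩
    · refine Continuous.integrable_of_hasCompactSupport ?_
        (HasCompactSupport.intro isCompact_Icc (hb0 s hs' p))
      exact hI.continuousOn.comp_continuous (f := fun b : ℝ => ((s, p), b)) (by fun_prop)
        fun b => ⟨hs', trivial⟩
    · exact contDiffOn_univ.1 (hδ.comp (f := fun p => (s, p)) (by fun_prop) fun p _ => hs')
    · exact HasCompactSupport.of_support_subset_isCompact hK (hsupp s hs')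
  · set B : Set (ℝ × ℝ) := Set.Icc (-M) M ×ˢ Set.Icc (-M) M with hB
    have hBm : MeasurableSet B := measurableSet_Icc.prod measurableSet_Icc
    have hBfin : volume B ≠ ⊤ := (isCompact_Icc.prod isCompact_Icc).measure_lt_top.ne
    have hS0 : ∀ᶠ s : ℝ in 𝓝 0, |s| < ε :=
      continuous_abs.continuousAt.eventually_lt_const (by simpa using hε)
    rw [ENNReal.tendsto_nhds_zero]
    intro e he
    obtain ⟨η, hη, hηe⟩ : ∃ η : ℝ, 0 < η ∧ ENNReal.ofReal η * volume B ≤ e := by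
      have ht : Tendsto (fun η : ℝ => ENNReal.ofReal η * volume B) (𝓝[>] 0) (𝓝 0) := by
        have := ENNReal.Tendsto.mul_const (b := volume B)
          (ENNReal.continuous_ofReal.tendsto 0) (Or.inr hBfin)
        simp only [ENNReal.ofReal_zero, zero_mul] at this
        exact this.mono_left nhdsWithin_le_nhds
      obtain ⟨η, h1, h2⟩ := (((ENNReal.tendsto_nhds_zero.1 ht) e he).and
        self_mem_nhdsWithin).exists
      exact ⟨η, h2, h1⟩
    have hunif : ∀ᶠ s : ℝ in 𝓝 0, ∀ p ∈ K,
        ‖AxPlusB.deltaHat s f F p - AxPlusB.deltaHat 0 f F p‖ < η := by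
      -- Tube lemma: joint continuity at each `(0, p)` gives uniformity over the compact `K`.
      refine hK.eventually_forall_of_forall_eventually fun p _ => ?_
      have hc1 : ContinuousAt (fun z : ℝ × ((ℝ × ℝ) × (ℝ × ℝ)) =>
          AxPlusB.deltaHat z.1 f F z.2) (0, p) :=
        hδ.continuousOn.continuousAt (hSo.mem_nhds (by simpa [hS] using hε))
      have hc2 : ContinuousAt (fun z : ℝ × ((ℝ × ℝ) × (ℝ × ℝ)) =>
          AxPlusB.deltaHat 0 f F z.2) (0, p) :=
        ContinuousAt.comp_of_eq (f := fun z : ℝ × ((ℝ × ℝ) × (ℝ × ℝ)) => ((0 : ℝ), z.2)) hc1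
          (by fun_prop) rfl
      exact (hc1.sub hc2).norm.eventually_lt_const (by simpa using hη)
    filter_upwards [hS0, hunif] with s hs hsη
    have hoff : ∀ p ∉ K, (AxPlusB.deltaHat s f F - AxPlusB.deltaHat 0 f F) p = 0 := by
      intro p hp
      have h1 : AxPlusB.deltaHat s f F p = 0 := by_contra fun h' => hp (hsupp s hs p h')
      have h2 : AxPlusB.deltaHat 0 f F p = 0 :=
        by_contra fun h' => hp (hsupp 0 (by simpa using hε) p h')
      simp [h1, h2]
    refine (AxPlusB.reducedNorm_le hBm (m := ENNReal.ofReal η) (fun p => ?_)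
      fun p hne => ?_).trans hηe
    · by_cases hp : p ∈ K
      · rw [← ofReal_norm]
        exact ENNReal.ofReal_le_ofReal (hsη p hp).le
      · simp [hoff p hp]
    · have hp : p ∈ K := by_contra fun hp => hne (hoff p hp)
      exact ⟨hp.1.1, hp.2.1⟩
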